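/- For a real number $y$ let $\|y\|$ denote its distance to the nearest integer. Let $b>a\geq 2$ be integers and let $\psi:\mathbb{N}\to(0,1)$ be a function. Set \[S_{a,b}(\psi)=\{x\in[0,1]: \max\{\|a^nx\|,\|b^nx\|\}<\psi(n)\text{ for infinitely many }n\in\mathbb{N}\}\] and $\tau=\liminf_{n\to\infty}\frac{\log_b(\psi(n)^{-1})}{n}\in[0,+\infty]$. If $\tau>1$, then the Hausdorff dimension of $S_{a,b}(\psi)$ is \[\dim_{\rm H}S_{a,b}(\psi)=\frac{\log_b\gcd(a,b)}{1+\tau},\] where the right-hand side is read as $0$ if $\tau=+\infty$. -/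

import Mathlib

open Filter

/-- The distance from a real number to the nearest integer. -/
noncomputable def distNearestInt (x : ℝ) : ℝ := |x - round x|

/-- The points `x` of `[0,1]` for which both `a ^ n * x` and `b ^ n * x` are at distance less than
`ψ n` from the integers, for infinitely many `n`. -/
def simulSet (a b : ℕ) (ψ : ℕ → ℝ) : Set ℝ :=
  {x | x ∈ Set.Icc (0 : ℝ) 1 ∧
    {n : ℕ | max (distNearestInt ((a : ℝ) ^ n * x)) (distNearestInt ((b : ℝ) ^ n * x)) < ψ n}.Infinite}

/-- The lower limit of `log_b (ψ n)⁻¹ / n`, as an extended real number (it may be `⊤`). -/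
noncomputable def lowerOrder (b : ℕ) (ψ : ℕ → ℝ) : EReal :=
  liminf (fun n : ℕ => ((Real.logb (b : ℝ) (ψ n)⁻¹ / (n : ℝ) : ℝ) : EReal)) atTop

/-! Let d = gcd(a,b). When ψ(n) ≤ b^(-tn) with t > 1, the nearest integers p, q to a^n x, b^n x
satisfy p b^n = q a^n for large n, so q/b^n is a fraction k/d^n and x lies within b^(-(1+t)n) of it.
Conversely, x within b^(-(1+t)n) of some k/d^n makes both distances at most b^(-tn). The set is thus
essentially a limsup set of intervals around the k/d^n.

Upper bound (`simulSet_dimH_le`): Hausdorff–Cantelli with these intervals. Lower bound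
(`le_simulSet_dimH`): ψ(n) > b^(-tn) may hold only on a sparse infinite set N, so
`le_dimH_limsup_near_div_pow` builds a Cantor set of base d^L digits placed at chosen positions.
They are packed until some n in N is affordable, then a gap from n to βn forces a good
approximation. Distinct digit sequences stay separated, so the map back to ordinary base m
expansions is Hölder onto [0,1]. -/

/-- The real number whose `j`-th digit `x j` sits at the position `q j` of its base `d` expansion. -/
noncomputable def sparseDigits {m : ℕ} (d : ℕ) (q : ℕ → ℕ) (x : ℕ → Fin m) : ℝ :=
  ∑' j, (x j : ℝ) * ((d : ℝ) ^ q j)⁻¹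

/-! ### Expansions with gaps between the digit positions -/

theorem base_pos_of_one_lt_pow {d L : ℕ} (h : 1 < d ^ L) : 1 ≤ d := by
  rcases Nat.eq_zero_or_pos d with rfl | hd
  · exact absurd h (not_lt.2 (pow_le_one₀ le_rfl zero_le_one))
  · exact hd

theorem add_mul_le_of_gaps {q : ℕ → ℕ} {L : ℕ} (hq : ∀ j, q j + L ≤ q (j + 1)) (j i : ℕ) :
    q j + L * i ≤ q (j + i) := by
  induction i with
  | zero => simp
  | succ i ih =>
    have := hq (j + i)
    rw [← add_assoc, mul_add]
    omega

theorem inv_pow_gaps_le {q : ℕ → ℕ} {L d : ℕ} (hd : 1 ≤ d) (hq : ∀ j, q j + L ≤ q (j + 1))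
    (j i : ℕ) : ((d : ℝ) ^ q (j + i))⁻¹ ≤ ((d : ℝ) ^ q j)⁻¹ * (((d : ℝ) ^ L)⁻¹) ^ i := by
  have h1 : (1 : ℝ) ≤ d := by exact_mod_cast hd
  rw [inv_pow, ← mul_inv, ← pow_mul, ← pow_add]
  exact inv_anti₀ (by positivity) (pow_le_pow_right₀ h1 (add_mul_le_of_gaps hq j i))

theorem summable_mul_inv_pow_gaps {q : ℕ → ℕ} {L d : ℕ} (hd : 1 < d ^ L)
    (hq : ∀ j, q j + L ≤ q (j + 1)) {c : ℕ → ℝ} {K : ℝ} (hc : ∀ i, |c i| ≤ K) (j : ℕ) :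
    Summable (fun i => c i * ((d : ℝ) ^ q (j + i))⁻¹) ∧
    |∑' i, c i * ((d : ℝ) ^ q (j + i))⁻¹| ≤
      K * ((d : ℝ) ^ q j)⁻¹ * (1 - ((d : ℝ) ^ L)⁻¹)⁻¹ := by
  have hd1 : 1 ≤ d := base_pos_of_one_lt_pow hd
  have hD : (1 : ℝ) < (d : ℝ) ^ L := by exact_mod_cast hd
  have hr : ((d : ℝ) ^ L)⁻¹ < 1 := inv_lt_one_of_one_lt₀ hD
  have hK : 0 ≤ K := (abs_nonneg _).trans (hc 0)
  have hg := (hasSum_geometric_of_lt_one (by positivity) hr).mul_left (K * ((d : ℝ) ^ q j)⁻¹)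
  have hle : ∀ i, ‖c i * ((d : ℝ) ^ q (j + i))⁻¹‖ ≤
      K * ((d : ℝ) ^ q j)⁻¹ * (((d : ℝ) ^ L)⁻¹) ^ i := fun i => by
    rw [norm_mul, Real.norm_eq_abs, Real.norm_of_nonneg (by positivity), mul_assoc]
    exact mul_le_mul (hc i) (inv_pow_gaps_le hd1 hq j i) (by positivity) hK
  exact ⟨hg.summable.of_norm_bounded hle, tsum_of_norm_bounded hg hle⟩

section Sparse

variable {d L m : ℕ} {q : ℕ → ℕ}

theorem summable_sparseDigits (hd : 1 < d ^ L) (hq : ∀ j, q j + L ≤ q (j + 1)) (x : ℕ → Fin m) :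
    Summable (fun j => (x j : ℝ) * ((d : ℝ) ^ q j)⁻¹) := by
  have := (summable_mul_inv_pow_gaps hd hq (c := fun i => (x i : ℝ)) (K := m) (fun i => by
    rw [abs_of_nonneg (by positivity)]
    exact_mod_cast (x i).2.le) 0).1
  simpa using this

theorem sparseDigits_nonneg (x : ℕ → Fin m) : 0 ≤ sparseDigits d q x :=
  tsum_nonneg fun _ => by positivity

theorem geometric_digit_bound {D : ℝ} (hD : 2 ≤ D) :
    (D - 2) * (1 - D⁻¹)⁻¹ = D - 1 - (D - 1)⁻¹ := by
  have h0 : D ≠ 0 := by linarith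
  have h1 : D - 1 ≠ 0 := by linarith
  have : 1 - D⁻¹ = (D - 1) / D := by field_simp
  rw [this]
  field_simp
  ring

/-- With m = d^L - 1, the top digit is forbidden. The geometric series then falls short of m by 1/m,
which is the room that separates distinct expansions. -/
theorem abs_tsum_digits_tail_le (hm : m + 1 = d ^ L) (hm1 : 1 < m)
    (hq : ∀ j, q j + L ≤ q (j + 1)) {c : ℕ → ℝ} (hc : ∀ i, |c i| ≤ m - 1) (j : ℕ) :
    |∑' i, c i * ((d : ℝ) ^ q (j + i))⁻¹| ≤ (m - (m : ℝ)⁻¹) * ((d : ℝ) ^ q j)⁻¹ := by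
  have h := (summable_mul_inv_pow_gaps (show 1 < d ^ L by omega) hq hc j).2
  have hmr : ((d : ℝ) ^ L) = m + 1 := by exact_mod_cast hm.symm
  have h1 : (1 : ℝ) < m := by exact_mod_cast hm1
  have hb := geometric_digit_bound (D := m + 1) (by linarith)
  rw [hmr] at h
  refine h.trans (le_of_eq ?_)
  have e1 : (m : ℝ) + 1 - 2 = m - 1 := by ring
  have e2 : (m : ℝ) + 1 - 1 = m := by ring
  rw [e1, e2] at hb
  rw [mul_right_comm, hb]

theorem digit_le_pred (x : Fin m) : (x : ℝ) ≤ m - 1 := by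
  have : ((x : ℕ) + 1 : ℝ) ≤ m := by exact_mod_cast x.2
  linarith

theorem sparseDigits_eq_sum_add (hd : 1 < d ^ L) (hq : ∀ j, q j + L ≤ q (j + 1)) (x : ℕ → Fin m)
    (j : ℕ) : sparseDigits d q x = ∑ i ∈ Finset.range j, (x i : ℝ) * ((d : ℝ) ^ q i)⁻¹ +
      ∑' i, (x (j + i) : ℝ) * ((d : ℝ) ^ q (j + i))⁻¹ := by
  have := (summable_sparseDigits hd hq x).sum_add_tsum_nat_add j
  rw [sparseDigits, ← this]
  simp_rw [add_comm j]

theorem abs_sparseDigits_sub_sum_le (hm : m + 1 = d ^ L) (hm1 : 1 < m)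
    (hq : ∀ j, q j + L ≤ q (j + 1)) (x : ℕ → Fin m) (j : ℕ) :
    |sparseDigits d q x - ∑ i ∈ Finset.range j, (x i : ℝ) * ((d : ℝ) ^ q i)⁻¹| ≤
      (m - (m : ℝ)⁻¹) * ((d : ℝ) ^ q j)⁻¹ := by
  rw [sparseDigits_eq_sum_add (by omega) hq x j, add_sub_cancel_left]
  exact abs_tsum_digits_tail_le hm hm1 hq (fun i => by
    rw [abs_of_nonneg (by positivity)]; exact digit_le_pred _) j

theorem sparseDigits_le_one (hm : m + 1 = d ^ L) (hm1 : 1 < m) (hq : ∀ j, q j + L ≤ q (j + 1))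
    (hq0 : L ≤ q 0) (x : ℕ → Fin m) : sparseDigits d q x ≤ 1 := by
  have h := abs_sparseDigits_sub_sum_le hm hm1 hq x 0
  simp only [Finset.range_zero, Finset.sum_empty, sub_zero] at h
  refine (le_abs_self _).trans (h.trans ?_)
  have hmr : ((d : ℝ) ^ L) = m + 1 := by exact_mod_cast hm.symm
  have h1 : (1 : ℝ) < m := by exact_mod_cast hm1
  have hd : (1 : ℝ) ≤ d := by
    exact_mod_cast base_pos_of_one_lt_pow (show 1 < d ^ L by omega)
  have h2 : (m : ℝ) + 1 ≤ (d : ℝ) ^ q 0 := hmr ▸ pow_le_pow_right₀ hd hq0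
  have h3 : 0 < (m : ℝ)⁻¹ := by positivity
  rw [← div_eq_mul_inv, div_le_one (by linarith)]
  linarith

/-- Truncating after digit j gives a denominator dividing d^n, and the error is governed by the next
position: a long gap means a good approximation. -/
theorem exists_abs_sparseDigits_sub_div_le (hm : m + 1 = d ^ L) (hm1 : 1 < m)
    (hq : ∀ j, q j + L ≤ q (j + 1)) (x : ℕ → Fin m) {j n : ℕ} (hn : q j ≤ n) :
    ∃ k : ℕ, |sparseDigits d q x - k / (d : ℝ) ^ n| ≤ (d : ℝ) ^ L * ((d : ℝ) ^ q (j + 1))⁻¹ := by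
  have h1 : (1 : ℝ) < m := by exact_mod_cast hm1
  have hd : (d : ℝ) ≠ 0 := by
    exact_mod_cast Nat.one_le_iff_ne_zero.1 (base_pos_of_one_lt_pow (show 1 < d ^ L by omega))
  refine ⟨∑ i ∈ Finset.range (j + 1), (x i : ℕ) * d ^ (n - q i), ?_⟩
  have hmono : Monotone q := monotone_nat_of_le_succ fun i => le_of_add_le_left (hq i)
  have : ((∑ i ∈ Finset.range (j + 1), (x i : ℕ) * d ^ (n - q i) : ℕ) : ℝ) / (d : ℝ) ^ n =
      ∑ i ∈ Finset.range (j + 1), (x i : ℝ) * ((d : ℝ) ^ q i)⁻¹ := by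
    push_cast
    rw [Finset.sum_div]
    refine Finset.sum_congr rfl fun i hi => ?_
    have hi : q i ≤ n := (hmono (Nat.lt_succ_iff.1 (Finset.mem_range.1 hi))).trans hn
    rw [pow_sub₀ _ hd hi]
    field_simp
  rw [this]
  refine (abs_sparseDigits_sub_sum_le hm hm1 hq x (j + 1)).trans ?_
  have hmr : ((d : ℝ) ^ L) = m + 1 := by exact_mod_cast hm.symm
  have h3 : 0 < (m : ℝ)⁻¹ := by positivity
  rw [hmr]
  gcongr
  linarith

/-- The first differing digit contributes at least d^(-q j). The gap L gains a factor m + 1, so the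
tails cancel at most the fraction 1 - 1/m of it. -/
theorem inv_pow_le_abs_sparseDigits_sub (hm : m + 1 = d ^ L) (hm1 : 1 < m)
    (hq : ∀ j, q j + L ≤ q (j + 1)) {x y : ℕ → Fin m} {j : ℕ} (hxy : ∀ i < j, x i = y i)
    (hj : x j ≠ y j) :
    (m : ℝ)⁻¹ * ((d : ℝ) ^ q j)⁻¹ ≤ |sparseDigits d q x - sparseDigits d q y| := by
  have hd : 1 < d ^ L := by omega
  have h1 : (1 : ℝ) < m := by exact_mod_cast hm1
  have hmr : ((d : ℝ) ^ L) = m + 1 := by exact_mod_cast hm.symm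
  have hd1 : 1 ≤ d := base_pos_of_one_lt_pow hd
  have hsum : ∀ z : ℕ → Fin m, Summable
      (fun i => (z (j + 1 + i) : ℝ) * ((d : ℝ) ^ q (j + 1 + i))⁻¹) := fun z => by
    simpa only [add_comm] using (summable_nat_add_iff (j + 1)).2 (summable_sparseDigits hd hq z)
  have htail := abs_tsum_digits_tail_le hm hm1 hq
    (c := fun i => (x (j + 1 + i) : ℝ) - y (j + 1 + i)) (fun i => by
      have hx := digit_le_pred (x (j + 1 + i))
      have hy := digit_le_pred (y (j + 1 + i))
      have hx0 : (0 : ℝ) ≤ (x (j + 1 + i) : ℕ) := by positivity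
      have hy0 : (0 : ℝ) ≤ (y (j + 1 + i) : ℕ) := by positivity
      rw [abs_le]; constructor <;> linarith) (j + 1)
  have hgap : ((d : ℝ) ^ q (j + 1))⁻¹ ≤ ((d : ℝ) ^ q j)⁻¹ * ((m : ℝ) + 1)⁻¹ := by
    simpa [hmr] using inv_pow_gaps_le hd1 hq j 1
  have hlead : 1 ≤ |(x j : ℝ) - y j| := by
    have : ((x j : ℕ) : ℤ) - (y j : ℕ) ≠ 0 := by
      intro h; exact hj (Fin.ext (by omega))
    exact_mod_cast Int.one_le_abs this
  have heq : sparseDigits d q x - sparseDigits d q y = ((x j : ℝ) - y j) * ((d : ℝ) ^ q j)⁻¹ +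
      ∑' i, ((x (j + 1 + i) : ℝ) - y (j + 1 + i)) * ((d : ℝ) ^ q (j + 1 + i))⁻¹ := by
    rw [sparseDigits_eq_sum_add hd hq x (j + 1), sparseDigits_eq_sum_add hd hq y (j + 1)]
    simp_rw [sub_mul]
    rw [(hsum x).tsum_sub (hsum y), Finset.sum_range_succ, Finset.sum_range_succ,
      Finset.sum_congr rfl fun i hi => by rw [hxy i (Finset.mem_range.1 hi)]]
    ring
  have hpos : 0 < ((d : ℝ) ^ q j)⁻¹ := by positivity
  have hA : ((d : ℝ) ^ q j)⁻¹ ≤ |((x j : ℝ) - y j) * ((d : ℝ) ^ q j)⁻¹| := by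
    rw [abs_mul, abs_of_pos hpos]
    exact le_mul_of_one_le_left hpos.le hlead
  have hB : |∑' i, ((x (j + 1 + i) : ℝ) - y (j + 1 + i)) * ((d : ℝ) ^ q (j + 1 + i))⁻¹| ≤
      (1 - (m : ℝ)⁻¹) * ((d : ℝ) ^ q j)⁻¹ := by
    refine htail.trans ?_
    have hmm : (m : ℝ) - (m : ℝ)⁻¹ = (1 - (m : ℝ)⁻¹) * (m + 1) := by field_simp; ring
    have hm0 : (0 : ℝ) ≤ 1 - (m : ℝ)⁻¹ := by
      have := inv_lt_one_of_one_lt₀ h1; linarith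
    rw [hmm, mul_assoc]
    refine mul_le_mul_of_nonneg_left ?_ hm0
    calc ((m : ℝ) + 1) * ((d : ℝ) ^ q (j + 1))⁻¹
        ≤ (m + 1) * (((d : ℝ) ^ q j)⁻¹ * ((m : ℝ) + 1)⁻¹) := by gcongr
      _ = ((d : ℝ) ^ q j)⁻¹ := by field_simp
  rw [heq]
  have := abs_sub_abs_le_abs_sub (((x j : ℝ) - y j) * ((d : ℝ) ^ q j)⁻¹)
    (-∑' i, ((x (j + 1 + i) : ℝ) - y (j + 1 + i)) * ((d : ℝ) ^ q (j + 1 + i))⁻¹)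
  rw [abs_neg, sub_neg_eq_add] at this
  linarith

end Sparse

/-! ### Dimension from below: Hölder inverses and Cantor sets -/

/-- A map on digit sequences whose inverse is Hölder towards the reals has a large range. -/
theorem le_dimH_range_of_abs_ofDigits_sub_le {m : ℕ} (hm : 1 < m) {g : (ℕ → Fin m) → ℝ}
    {s C : NNReal} (hs : 0 < s)
    (h : ∀ x y, |Real.ofDigits x - Real.ofDigits y| ≤ C * |g x - g y| ^ (s : ℝ)) :
    (s : ENNReal) ≤ dimH (Set.range g) := by
  have : NeZero m := ⟨by omega⟩
  have hH : HolderOnWith C s (fun t => Real.ofDigits (Function.invFun g t)) (Set.range g) := by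
    intro t ht u hu
    have h' := h (Function.invFun g t) (Function.invFun g u)
    rw [Function.invFun_eq ht, Function.invFun_eq hu] at h'
    rw [edist_dist, edist_dist, Real.dist_eq, Real.dist_eq,
      ENNReal.ofReal_rpow_of_nonneg (abs_nonneg (t - u)) s.coe_nonneg, ← ENNReal.ofReal_coe_nnreal,
      ← ENNReal.ofReal_mul C.coe_nonneg]
    exact ENNReal.ofReal_le_ofReal h'
  have hsub : Set.Icc (0 : ℝ) 1 ⊆ (fun t => Real.ofDigits (Function.invFun g t)) '' Set.range g := by
    intro t ht
    obtain ⟨x, -, hx⟩ := Real.ofDigits_SurjOn hm ht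
    refine ⟨g x, ⟨x, rfl⟩, ?_⟩
    have h' := h (Function.invFun g (g x)) x
    rw [Function.invFun_eq (f := g) ⟨x, rfl⟩, sub_self, abs_zero,
      Real.zero_rpow (NNReal.coe_ne_zero.2 hs.ne'), mul_zero] at h'
    rw [← hx]
    exact sub_eq_zero.1 (abs_nonpos_iff.1 h')
  have h1 : dimH (Set.Icc (0 : ℝ) 1) = 1 := by
    rw [Real.dimH_of_nonempty_interior (by rw [interior_Icc]; exact ⟨1 / 2, by norm_num⟩)]
    simp
  have h2 := (h1 ▸ dimH_mono hsub).trans (hH.dimH_image_le hs)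
  have hs0 : (s : ENNReal) ≠ 0 := by exact_mod_cast hs.ne'
  rwa [ENNReal.le_div_iff_mul_le (.inl hs0) (.inl ENNReal.coe_ne_top), one_mul] at h2

/-- A sequence of positions growing at the average rate `β'` which leaves, infinitely often, a gap
reaching from an element `n` of `N` to beyond `β * n`. -/
theorem exists_gap_sequence {N : Set ℕ} (hN : N.Infinite) {β β' : ℝ} (h1 : 1 ≤ β) (hβ : β < β')
    {L : ℕ} (hL : 0 < L) :
    ∃ q : ℕ → ℕ, q 0 = L ∧ (∀ j, q j + L ≤ q (j + 1)) ∧ (∀ j, (q j : ℝ) ≤ β' * (L * j) + L) ∧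
      ∃ᶠ j in atTop, ∃ n ∈ N, q j ≤ n ∧ β * n + L ≤ q (j + 1) := by
  -- Advance by L unless a jump past βn, for some n in N with n ≥ u, fits the budget β'L(j+1); the
  -- rounding up of βn costs the 1.
  have step : ∀ j u : ℕ, ∃ v : ℕ, u + L ≤ v ∧ (v = u + L ∨ (v : ℝ) ≤ β' * (L * (j + 1)) + L) ∧
      ((∃ n ∈ N, u ≤ n ∧ β * n + 1 ≤ β' * (L * (j + 1))) → ∃ n ∈ N, u ≤ n ∧ β * n + L ≤ v) ∧
      ((¬ ∃ n ∈ N, u ≤ n ∧ β * n + 1 ≤ β' * (L * (j + 1))) → v = u + L) := by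
    intro j u
    by_cases h : ∃ n ∈ N, u ≤ n ∧ β * n + 1 ≤ β' * (L * (j + 1))
    · obtain ⟨n, hn, hun, hle⟩ := h
      have hn0 : (0 : ℝ) ≤ n := by positivity
      have hc1 := Nat.le_ceil (β * n)
      have hc2 := Nat.ceil_lt_add_one (a := β * n) (by positivity)
      have hnc : n ≤ ⌈β * n⌉₊ := by
        have : (n : ℝ) ≤ ⌈β * n⌉₊ := by nlinarith
        exact_mod_cast this
      refine ⟨⌈β * n⌉₊ + L, by omega, Or.inr ?_, fun _ => ⟨n, hn, hun, ?_⟩, fun h' =>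
        absurd ⟨n, hn, hun, hle⟩ h'⟩
      · push_cast; linarith
      · push_cast; linarith
    · exact ⟨u + L, le_rfl, Or.inl rfl, fun h' => absurd h' h, fun _ => rfl⟩
  choose f hf1 hf2 hf3 hf4 using step
  obtain ⟨q, hq0, hq⟩ : ∃ q : ℕ → ℕ, q 0 = L ∧ ∀ j, q (j + 1) = f j (q j) :=
    ⟨fun j => Nat.rec L f j, rfl, fun _ => rfl⟩
  have hβ' : 1 ≤ β' := h1.trans hβ.le
  have hLr : (0 : ℝ) < L := by exact_mod_cast hL
  refine ⟨q, hq0, fun j => hq j ▸ hf1 j (q j), fun j => ?_, ?_⟩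
  · induction j with
    | zero => simp [hq0]
    | succ j ih =>
      rw [hq]
      push_cast
      rcases hf2 j (q j) with h | h
      · rw [h]; push_cast; nlinarith
      · exact h
  · rw [frequently_atTop]
    intro j₀
    by_contra! hcon
    have hno : ∀ j ≥ j₀, ¬ ∃ n ∈ N, q j ≤ n ∧ β * n + 1 ≤ β' * (L * (j + 1)) := fun j hj h => by
      obtain ⟨n, hn, hle, hv⟩ := hf3 j (q j) h
      exact absurd hv (not_le.2 (hq j ▸ hcon j hj n hn hle))
    -- Without further jumps the positions grow at rate 1 per L, while the budget grows at rate β' >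
    -- β, so a large n in N becomes affordable.
    have hlin : ∀ i, q (j₀ + i) = q j₀ + L * i := fun i => by
      induction i with
      | zero => simp
      | succ i ih =>
        rw [← add_assoc, hq, hf4 _ _ (hno (j₀ + i) (by omega)), ih]
        ring
    obtain ⟨n, hn, hbig⟩ := hN.exists_gt (⌈(1 + β' * q j₀) / (β' - β)⌉₊ + q j₀)
    have hbig1 : (1 + β' * q j₀) / (β' - β) ≤ n :=
      (Nat.le_ceil _).trans (by exact_mod_cast (by omega : ⌈(1 + β' * q j₀) / (β' - β)⌉₊ ≤ n))
    rw [div_le_iff₀ (by linarith)] at hbig1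
    have hdiv := Nat.div_add_mod (n - q j₀) L
    have hmod := Nat.mod_lt (n - q j₀) hL
    set i := (n - q j₀) / L
    have hlt : (n : ℝ) ≤ q j₀ + L * i + L := by
      exact_mod_cast (by omega : n ≤ q j₀ + L * i + L)
    refine hno (j₀ + i) (Nat.le_add_right _ _) ⟨n, hn, ?_, ?_⟩
    · rw [hlin]; omega
    · have : (n : ℝ) - q j₀ ≤ L * ((j₀ + i : ℕ) + 1) := by
        push_cast
        have : (0 : ℝ) ≤ L * j₀ := by positivity
        linarith
      nlinarith [mul_le_mul_of_nonneg_left this (by linarith : (0 : ℝ) ≤ β')]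

/-- For a long enough block length L, giving up one digit of base d^L costs less than the slack 1 -
θ in the exponent. -/
theorem exists_rpow_add_one_le {d : ℕ} (hd : 2 ≤ d) {θ : ℝ} (hθ : θ < 1) :
    ∃ L : ℕ, 2 ≤ L ∧ ((d : ℝ) ^ L) ^ θ + 1 ≤ (d : ℝ) ^ L := by
  obtain ⟨L, hL⟩ := exists_nat_ge (1 / (1 - θ))
  refine ⟨L + 2, by omega, ?_⟩
  set D : ℝ := (d : ℝ) ^ (L + 2) with hDdef
  have hd2 : (2 : ℝ) ≤ d := by exact_mod_cast hd
  have hD1 : 1 ≤ D := one_le_pow₀ (by linarith)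
  have h1 : 2 ≤ D ^ (1 - θ) := by
    have e : D ^ (1 - θ) = (d : ℝ) ^ (((L + 2 : ℕ) : ℝ) * (1 - θ)) := by
      rw [hDdef, ← Real.rpow_natCast, ← Real.rpow_mul (by linarith)]
    rw [e]
    have : 1 ≤ ((L + 2 : ℕ) : ℝ) * (1 - θ) := by
      rw [div_le_iff₀ (by linarith)] at hL
      push_cast
      nlinarith
    calc (2 : ℝ) ≤ (d : ℝ) ^ (1 : ℝ) := by simpa using hd2
      _ ≤ _ := Real.rpow_le_rpow_of_exponent_le (by linarith) this
  have h2 : D = D ^ θ * D ^ (1 - θ) := by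
    rw [← Real.rpow_add (by linarith)]; simp
  rcases le_or_gt 0 θ with h0 | h0
  · have : 1 ≤ D ^ θ := Real.one_le_rpow hD1 h0
    nlinarith
  · have : D ^ θ ≤ 1 := Real.rpow_le_one_of_one_le_of_nonpos hD1 h0.le
    have : (2 : ℝ) ^ 2 ≤ D := by
      calc (2 : ℝ) ^ 2 ≤ (d : ℝ) ^ 2 := by gcongr
        _ ≤ _ := pow_le_pow_right₀ (by linarith) (by omega)
    linarith

/-- Points that are infinitely often close to rationals with denominator a power of `d`. -/
theorem le_dimH_limsup_near_div_pow {d : ℕ} (hd : 2 ≤ d) {N : Set ℕ} (hN : N.Infinite) {β : ℝ}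
    (hβ : 1 ≤ β) :
    ENNReal.ofReal (1 / β) ≤ dimH {x : ℝ | x ∈ Set.Icc (0 : ℝ) 1 ∧
      {n ∈ N | ∃ k : ℕ, |x - k / (d : ℝ) ^ n| ≤ (d : ℝ) ^ (-(β * n))}.Infinite} := by
  refine ENNReal.le_of_forall_nnreal_lt fun s hs => ?_
  rcases eq_or_ne s 0 with rfl | hs0
  · simp
  have hspos : 0 < s := pos_iff_ne_zero.2 hs0
  have hsr : (0 : ℝ) < s := by exact_mod_cast hspos
  have hs1 : (s : ℝ) < 1 / β := by
    rwa [← ENNReal.ofReal_coe_nnreal, ENNReal.ofReal_lt_ofReal_iff (by positivity)] at hs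
  obtain ⟨β', hβ', hβ's⟩ : ∃ β', β < β' ∧ β' < 1 / (s : ℝ) :=
    exists_between ((lt_one_div hsr (by linarith)).1 hs1)
  have hθ : β' * s < 1 := by rwa [lt_div_iff₀ hsr] at hβ's
  obtain ⟨L, hL2, hL⟩ := exists_rpow_add_one_le hd hθ
  obtain ⟨q, hq0, hq, hqle, hfreq⟩ := exists_gap_sequence hN hβ hβ' (L := L) (by omega)
  have hd2 : (2 : ℝ) ≤ d := by exact_mod_cast hd
  have hd0 : (0 : ℝ) < d := by linarith
  have hD4 : 4 ≤ d ^ L := by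
    calc 4 = 2 ^ 2 := rfl
      _ ≤ d ^ 2 := by gcongr
      _ ≤ d ^ L := Nat.pow_le_pow_right (by omega) hL2
  obtain ⟨m, hm⟩ : ∃ m, m + 1 = d ^ L := ⟨d ^ L - 1, by omega⟩
  have hm1 : 1 < m := by omega
  have hmr : ((d : ℝ) ^ L) = m + 1 := by exact_mod_cast hm.symm
  have hm0 : (0 : ℝ) < m := by positivity
  have hqj : ∀ j, j ≤ q j := fun j => by
    have := add_mul_le_of_gaps hq 0 j
    rw [zero_add] at this
    nlinarith
  have hsub : Set.range (sparseDigits (m := m) d q) ⊆ {x : ℝ | x ∈ Set.Icc (0 : ℝ) 1 ∧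
      {n ∈ N | ∃ k : ℕ, |x - k / (d : ℝ) ^ n| ≤ (d : ℝ) ^ (-(β * n))}.Infinite} := by
    rintro _ ⟨x, rfl⟩
    refine ⟨⟨sparseDigits_nonneg x, sparseDigits_le_one hm hm1 hq hq0.ge x⟩, ?_⟩
    rw [Set.infinite_iff_exists_gt]
    intro M
    obtain ⟨j, hj, n, hn, hqn, hgap⟩ := frequently_atTop.1 hfreq (M + 1)
    obtain ⟨k, hk⟩ := exists_abs_sparseDigits_sub_div_le hm hm1 hq x hqn
    refine ⟨n, ⟨hn, k, hk.trans ?_⟩, by have := hqj j; omega⟩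
    rw [← Real.rpow_natCast, ← Real.rpow_natCast, ← Real.rpow_neg hd0.le, ← Real.rpow_add hd0]
    exact Real.rpow_le_rpow_of_exponent_le (by linarith) (by linarith)
  refine le_trans ?_ (dimH_mono hsub)
  -- The factor m^s absorbs the separation constant 1/m, and (d^L)^s the additive L in the bound on
  -- `q`.
  refine le_dimH_range_of_abs_ofDigits_sub_le hm1
    (C := NNReal.mk ((m : ℝ) ^ (s : ℝ) * ((d : ℝ) ^ L) ^ (s : ℝ)) (by positivity)) hspos fun x y => ?_
  rcases eq_or_ne x y with rfl | hxy
  · simp only [sub_self, abs_zero]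
    exact mul_nonneg (NNReal.coe_nonneg _) (Real.rpow_nonneg le_rfl _)
  classical
  have hex : ∃ j, x j ≠ y j := Function.ne_iff.1 hxy
  set J := Nat.find hex with hJ
  have hbefore : ∀ i < J, x i = y i := fun i hi => not_not.1 (Nat.find_min hex hi)
  refine (Real.abs_ofDigits_sub_ofDigits_le hbefore).trans ?_
  have hsep := inv_pow_le_abs_sparseDigits_sub hm hm1 hq hbefore (Nat.find_spec hex)
  refine le_trans ?_ (mul_le_mul_of_nonneg_left
    (Real.rpow_le_rpow (by positivity) hsep hsr.le) (NNReal.coe_nonneg _))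
  rw [NNReal.coe_mk, Real.mul_rpow (by positivity) (by positivity), Real.inv_rpow hm0.le]
  have hmain : (((d : ℝ) ^ q J) ^ (s : ℝ)) ≤ ((d : ℝ) ^ L) ^ (s : ℝ) * (m : ℝ) ^ J := by
    calc ((d : ℝ) ^ q J) ^ (s : ℝ) = (d : ℝ) ^ ((q J : ℝ) * s) := by
          rw [← Real.rpow_natCast, ← Real.rpow_mul hd0.le]
      _ ≤ (d : ℝ) ^ ((L : ℝ) * s + L * (β' * s) * J) := by
          refine Real.rpow_le_rpow_of_exponent_le (by linarith) ?_
          have := mul_le_mul_of_nonneg_right (hqle J) hsr.le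
          linarith
      _ = ((d : ℝ) ^ L) ^ (s : ℝ) * (((d : ℝ) ^ L) ^ (β' * s)) ^ J := by
          rw [Real.rpow_add hd0, Real.rpow_mul hd0.le, Real.rpow_mul hd0.le, Real.rpow_mul hd0.le,
            Real.rpow_natCast, Real.rpow_natCast]
      _ ≤ ((d : ℝ) ^ L) ^ (s : ℝ) * (m : ℝ) ^ J := by
          gcongr
          linarith
  have hms : (m : ℝ) ^ (s : ℝ) ≠ 0 := by positivity
  rw [Real.inv_rpow (by positivity)]
  have e : (m : ℝ) ^ (s : ℝ) * ((d : ℝ) ^ L) ^ (s : ℝ) *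
      (((m : ℝ) ^ (s : ℝ))⁻¹ * (((d : ℝ) ^ q J) ^ (s : ℝ))⁻¹) =
      ((d : ℝ) ^ L) ^ (s : ℝ) / ((d : ℝ) ^ q J) ^ (s : ℝ) := by
    field_simp
  rw [e, le_div_iff₀ (by positivity), inv_mul_le_iff₀ (by positivity), mul_comm]
  exact hmain

/-! ### Dimension from above: Hausdorff–Cantelli -/

open MeasureTheory in
/-- The Hausdorff–Cantelli lemma. -/
theorem hausdorffMeasure_frequently_mem_eq_zero {X : Type*} [EMetricSpace X] [MeasurableSpace X]
    [BorelSpace X] {ι : ℕ → Type*} [∀ n, Countable (ι n)] (t : ∀ n, ι n → Set X) {s : ℝ}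
    (hs : 0 < s) (h : ∑' n, ∑' i, Metric.ediam (t n i) ^ s ≠ ⊤) :
    Measure.hausdorffMeasure s {x | ∃ᶠ n in atTop, ∃ i, x ∈ t n i} = 0 := by
  set S : ℕ → ENNReal := fun M => ∑' n, ∑' i, Metric.ediam (t (n + M) i) ^ s with hS
  have hS0 : Tendsto S atTop (nhds 0) := ENNReal.tendsto_sum_nat_add _ h
  -- Each diameter in the M-th tail is at most this root of the tail sum, so the tails are covers of
  -- vanishing mesh.
  have hr : Tendsto (fun M => S M ^ (1 / s)) atTop (nhds 0) := by
    have := (ENNReal.continuous_rpow_const (y := 1 / s)).continuousAt.tendsto.comp hS0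
    simpa [Function.comp_def, ENNReal.zero_rpow_of_pos, hs] using this
  have key := Measure.hausdorffMeasure_le_liminf_tsum (ι := fun M => Σ n, ι (n + M)) s
    {x | ∃ᶠ n in atTop, ∃ i, x ∈ t n i} (fun M => S M ^ (1 / s)) hr (fun M p => t (p.1 + M) p.2)
    (Eventually.of_forall fun M p => by
      rw [one_div, ENNReal.le_rpow_inv_iff hs]
      exact (ENNReal.le_tsum (f := fun i => Metric.ediam (t (p.1 + M) i) ^ s) p.2).trans
        (ENNReal.le_tsum (f := fun n => ∑' i, Metric.ediam (t (n + M) i) ^ s) p.1))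
    (Eventually.of_forall fun M x hx => by
      obtain ⟨n, hn, i, hi⟩ := frequently_atTop.1 hx M
      obtain ⟨n, rfl⟩ := Nat.exists_eq_add_of_le' hn
      exact Set.mem_iUnion.2 ⟨⟨n, i⟩, hi⟩)
  simp_rw [ENNReal.tsum_sigma'] at key
  rw [hS0.liminf_eq] at key
  exact le_antisymm key bot_le

/-! ### Arithmetic of the gcd and the two bounds for `simulSet` -/

theorem round_mono {x y : ℝ} (h : x ≤ y) : round x ≤ round y := by
  rw [round_eq, round_eq]
  exact Int.floor_mono (by linarith)

/-- If `a ^ n * x` and `b ^ n * x` are both very close to integers, then `x` is close to a rational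
whose denominator divides the `n`-th power of `gcd a b`. -/
theorem exists_abs_sub_div_gcd_pow_lt {a b n : ℕ} (ha : 0 < a) (hab : a ≤ b) {x δ : ℝ}
    (hx : x ∈ Set.Icc (0 : ℝ) 1) (hδ : 2 * (b : ℝ) ^ n * δ ≤ 1)
    (h : max (distNearestInt ((a : ℝ) ^ n * x)) (distNearestInt ((b : ℝ) ^ n * x)) < δ) :
    ∃ k : ℕ, k ≤ Nat.gcd a b ^ n ∧ |x - k / (Nat.gcd a b : ℝ) ^ n| < δ / (b : ℝ) ^ n := by
  obtain ⟨h1, h2⟩ := max_lt_iff.1 h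
  unfold distNearestInt at h1 h2
  have hb : 0 < b := by omega
  have hd : 0 < Nat.gcd a b := Nat.gcd_pos_of_pos_left _ ha
  have ha0 : (0 : ℝ) < (a : ℝ) ^ n := by positivity
  have hb0 : (0 : ℝ) < (b : ℝ) ^ n := by positivity
  have habn : (a : ℝ) ^ n ≤ (b : ℝ) ^ n := by gcongr
  set p := round ((a : ℝ) ^ n * x)
  set q := round ((b : ℝ) ^ n * x) with hq
  have hpq : p * (b : ℤ) ^ n = q * (a : ℤ) ^ n := by
    -- The integer is smaller than δ(a^n + b^n) ≤ 2 b^n δ ≤ 1, hence zero.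
    have hlt : |(p : ℝ) * (b : ℝ) ^ n - q * (a : ℝ) ^ n| < 1 := by
      have e : (p : ℝ) * (b : ℝ) ^ n - q * (a : ℝ) ^ n =
          ((b : ℝ) ^ n * x - q) * (a : ℝ) ^ n - ((a : ℝ) ^ n * x - p) * (b : ℝ) ^ n := by ring
      rw [e]
      refine (abs_sub _ _).trans_lt ?_
      rw [abs_mul, abs_mul, abs_of_pos ha0, abs_of_pos hb0]
      have h3 := mul_lt_mul_of_pos_right h1 hb0
      have h4 := mul_le_mul h2.le habn ha0.le ((abs_nonneg _).trans h2.le)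
      linarith
    have hlt' : |p * (b : ℤ) ^ n - q * (a : ℤ) ^ n| < 1 := by exact_mod_cast hlt
    exact sub_eq_zero.1 (Int.abs_lt_one_iff.1 hlt')
  obtain ⟨a', ha'⟩ := Nat.gcd_dvd_left a b
  obtain ⟨b', hb'⟩ := Nat.gcd_dvd_right a b
  have hcop : Nat.Coprime b' a' := by
    have := Nat.coprime_div_gcd_div_gcd hd
    rw [Nat.div_eq_of_eq_mul_right hd ha', Nat.div_eq_of_eq_mul_right hd hb'] at this
    exact this.symm
  set d := Nat.gcd a b
  have hb'0 : 0 < b' := Nat.pos_of_ne_zero (by rintro rfl; omega)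
  have hpq' : p * (b' : ℤ) ^ n = q * (a' : ℤ) ^ n := by
    have hdz : ((d : ℤ) ^ n) ≠ 0 := by positivity
    apply mul_left_cancel₀ hdz
    have e1 : (b : ℤ) = d * b' := by exact_mod_cast hb'
    have e2 : (a : ℤ) = d * a' := by exact_mod_cast ha'
    rw [e1, e2, mul_pow, mul_pow] at hpq
    linarith
  have hdvd : (b' : ℤ) ^ n ∣ q := by
    have hc : IsCoprime ((b' : ℤ) ^ n) ((a' : ℤ) ^ n) := (Nat.isCoprime_iff_coprime.2 hcop).pow
    exact hc.dvd_of_dvd_mul_right ⟨p, by rw [← hpq']; ring⟩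
  obtain ⟨k, hk⟩ := hdvd
  have hbz : (0 : ℤ) < (b' : ℤ) ^ n := by positivity
  have hq0 : 0 ≤ q := by
    have := round_mono (mul_nonneg hb0.le hx.1)
    rwa [round_zero] at this
  have hq1 : q ≤ (b : ℤ) ^ n := by
    have := round_mono (mul_le_of_le_one_right hb0.le hx.2)
    rw [show (b : ℝ) ^ n = ((b ^ n : ℕ) : ℝ) by push_cast; rfl, round_natCast] at this
    push_cast at this
    exact this
  have hk0 : 0 ≤ k := by
    rw [hk] at hq0
    exact nonneg_of_mul_nonneg_right hq0 hbz
  have hk1 : k ≤ (d : ℤ) ^ n := by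
    rw [hk, hb'] at hq1
    push_cast at hq1
    rw [mul_pow, mul_comm ((d : ℤ) ^ n)] at hq1
    exact le_of_mul_le_mul_left hq1 hbz
  lift k to ℕ using hk0
  refine ⟨k, by exact_mod_cast hk1, ?_⟩
  have hd0 : (0 : ℝ) < (d : ℝ) ^ n := by positivity
  have hb'r : (0 : ℝ) < (b' : ℝ) ^ n := by positivity
  have hbr : (b : ℝ) ^ n = (d : ℝ) ^ n * (b' : ℝ) ^ n := by
    rw [← mul_pow]; exact_mod_cast congrArg (fun t : ℕ => (t : ℝ) ^ n) hb'
  rw [lt_div_iff₀ hb0, ← abs_of_pos hb0, ← abs_mul]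
  have e : (x - k / (d : ℝ) ^ n) * (b : ℝ) ^ n = (b : ℝ) ^ n * x - q := by
    rw [hk]; push_cast; rw [hbr]; field_simp
  rwa [e]

/-- Level n needs d^n + 1 intervals of length 2b^(-(1+t)n). Their s-sums are dominated by a
geometric series of ratio d b^(-(1+t)s), less than 1 exactly when s > log_b d/(1+t). The condition t
> 1 makes b^n ψ(n) small. -/
theorem simulSet_dimH_le {a b : ℕ} (ha : 2 ≤ a) (hab : a < b) {ψ : ℕ → ℝ} {t : ℝ} (ht : 1 < t)
    (hψ : ∀ᶠ n : ℕ in atTop, ψ n ≤ (b : ℝ) ^ (-(t * n))) :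
    dimH (simulSet a b ψ) ≤ ENNReal.ofReal (Real.logb b (Nat.gcd a b) / (1 + t)) := by
  set d := Nat.gcd a b with hddef
  have hd : 0 < d := Nat.gcd_pos_of_pos_left _ (by omega)
  have hd1 : (1 : ℝ) ≤ d := by exact_mod_cast hd
  have hb1 : (1 : ℝ) < b := by exact_mod_cast (by omega : 1 < b)
  have hb0 : (0 : ℝ) < b := by linarith
  have hlog : 0 ≤ Real.logb b d := Real.logb_nonneg hb1 hd1
  refine le_of_forall_gt_imp_ge_of_dense fun c hc => ?_
  obtain ⟨s, hs, hsc⟩ := ENNReal.lt_iff_exists_nnreal_btwn.1 hc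
  refine le_trans ?_ hsc.le
  have hs' : Real.logb b d / (1 + t) < s := by
    rw [← ENNReal.ofReal_coe_nnreal] at hs
    exact (ENNReal.ofReal_lt_ofReal_iff'.1 hs).1
  have hspos : (0 : ℝ) < s := lt_of_le_of_lt (by positivity) hs'
  set r : ℕ → ℝ := fun n => (b : ℝ) ^ (-((1 + t) * n)) with hr
  have hsub : simulSet a b ψ ⊆ {x | ∃ᶠ n in atTop, ∃ k : Fin (d ^ n + 1),
      x ∈ Set.Icc ((k : ℕ) / (d : ℝ) ^ n - r n) ((k : ℕ) / (d : ℝ) ^ n + r n)} := by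
    rintro x ⟨hx, hinf⟩
    have hsmall : ∀ᶠ n : ℕ in atTop, 2 * (b : ℝ) ^ n * (b : ℝ) ^ (-(t * n)) ≤ 1 := by
      have hlt : (b : ℝ) ^ (1 - t) < 1 := Real.rpow_lt_one_of_one_lt_of_neg hb1 (by linarith)
      have := (tendsto_pow_atTop_nhds_zero_of_lt_one (by positivity) hlt).eventually_le_const
        (show (0 : ℝ) < 1 / 2 by norm_num)
      filter_upwards [this] with n hn
      have e : (b : ℝ) ^ n * (b : ℝ) ^ (-(t * n)) = ((b : ℝ) ^ (1 - t)) ^ n := by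
        rw [← Real.rpow_natCast, ← Real.rpow_natCast, ← Real.rpow_add hb0, ← Real.rpow_mul hb0.le]
        congr 1; ring
      rw [mul_assoc, e]
      linarith
    refine ((Nat.frequently_atTop_iff_infinite.2 hinf).and_eventually (hψ.and hsmall)).mono ?_
    rintro n ⟨hn, hn1, hn2⟩
    obtain ⟨k, hk, hlt⟩ := exists_abs_sub_div_gcd_pow_lt (by omega) hab.le hx hn2 (hn.trans_le hn1)
    refine ⟨⟨k, Nat.lt_succ_of_le hk⟩, ?_⟩
    have e : (b : ℝ) ^ (-(t * n)) / (b : ℝ) ^ n = r n := by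
      rw [hr, ← Real.rpow_natCast, ← Real.rpow_sub hb0]
      congr 1; ring
    rw [e, abs_sub_lt_iff] at hlt
    constructor <;> simp only <;> linarith [hlt.1, hlt.2]
  refine (dimH_mono hsub).trans (dimH_le_of_hausdorffMeasure_ne_top ?_)
  rw [hausdorffMeasure_frequently_mem_eq_zero
    (fun n (k : Fin (d ^ n + 1)) =>
      Set.Icc ((k : ℕ) / (d : ℝ) ^ n - r n) ((k : ℕ) / (d : ℝ) ^ n + r n)) hspos ?_]
  · exact ENNReal.zero_ne_top
  set ρ : ℝ := d * (b : ℝ) ^ (-((1 + t) * s)) with hρ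
  have hρ1 : ρ < 1 := by
    rw [div_lt_iff₀ (by linarith), Real.logb_lt_iff_lt_rpow hb1 (by linarith)] at hs'
    rw [hρ, Real.rpow_neg hb0.le, ← div_eq_mul_inv, div_lt_one (by positivity), mul_comm]
    exact hs'
  have hρ0 : 0 ≤ ρ := by positivity
  refine ne_top_of_le_ne_top (ENNReal.ofReal_ne_top (r := ∑' n : ℕ, 2 * 2 ^ (s : ℝ) * ρ ^ n)) ?_
  rw [ENNReal.ofReal_tsum_of_nonneg (fun n => by positivity)
    ((summable_geometric_of_lt_one hρ0 hρ1).mul_left _)]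
  refine ENNReal.tsum_le_tsum fun n => ?_
  have hrn : 0 ≤ r n := by positivity
  simp_rw [Real.ediam_Icc, add_sub_sub_cancel]
  rw [tsum_fintype, Finset.sum_const, Finset.card_univ, Fintype.card_fin, nsmul_eq_mul,
    ENNReal.ofReal_rpow_of_nonneg (by positivity) hspos.le, ← ENNReal.ofReal_natCast,
    ← ENNReal.ofReal_mul (by positivity)]
  refine ENNReal.ofReal_le_ofReal ?_
  have e : ρ ^ n = (d : ℝ) ^ n * (r n) ^ (s : ℝ) := by
    rw [hρ, mul_pow, hr, ← Real.rpow_natCast, ← Real.rpow_natCast, ← Real.rpow_mul hb0.le,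
      ← Real.rpow_mul hb0.le]
    congr 2; ring
  rw [e, ← two_mul, Real.mul_rpow (by norm_num) hrn]
  have h1 : (1 : ℝ) ≤ (d : ℝ) ^ n := one_le_pow₀ hd1
  push_cast
  have h2 : (0 : ℝ) ≤ 2 ^ (s : ℝ) * r n ^ (s : ℝ) := by positivity
  nlinarith

/-- The exponent β = (1+t)/log_b d turns d^(-βn) into b^(-(1+t)n), and β ≥ 1 because d ≤ b.
Multiplying k/d^n by a^n or b^n gives an integer and enlarges the error by at most b^n. If d = 1 the
bound is 0. -/
theorem le_simulSet_dimH {a b : ℕ} (ha : 2 ≤ a) (hab : a < b) {ψ : ℕ → ℝ} {t : ℝ} (ht : 0 ≤ t)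
    (hψ : ∃ᶠ n : ℕ in atTop, (b : ℝ) ^ (-(t * n)) < ψ n) :
    ENNReal.ofReal (Real.logb b (Nat.gcd a b) / (1 + t)) ≤ dimH (simulSet a b ψ) := by
  rcases Nat.lt_or_ge (Nat.gcd a b) 2 with hlt | hd
  · have : Nat.gcd a b = 1 := by
      have := Nat.gcd_pos_of_pos_left b (by omega : 0 < a)
      omega
    simp [this]
  obtain ⟨a', ha'⟩ := Nat.gcd_dvd_left a b
  obtain ⟨b', hb'⟩ := Nat.gcd_dvd_right a b
  have hdb : Nat.gcd a b ≤ b := Nat.gcd_le_right _ (by omega)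
  set d := Nat.gcd a b
  have hd1 : (1 : ℝ) < d := by exact_mod_cast (by omega : 1 < d)
  have hd0 : (0 : ℝ) < d := by linarith
  have hb1 : (1 : ℝ) < b := by exact_mod_cast (by omega : 1 < b)
  have hb0 : (0 : ℝ) < b := by linarith
  have hlog : 0 < Real.logb b d := Real.logb_pos hb1 hd1
  have hlog1 : Real.logb b d ≤ 1 := by
    rw [Real.logb_le_iff_le_rpow hb1 hd0, Real.rpow_one]
    exact_mod_cast hdb
  have hβ : 1 ≤ (1 + t) / Real.logb b d := by
    rw [one_le_div hlog]; linarith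
  have key := le_dimH_limsup_near_div_pow hd (Nat.frequently_atTop_iff_infinite.1 hψ) hβ
  rw [one_div_div] at key
  refine key.trans (dimH_mono ?_)
  rintro x ⟨hx, hinf⟩
  refine ⟨hx, hinf.mono ?_⟩
  rintro n ⟨hn, k, hk⟩
  have e : (d : ℝ) ^ (-((1 + t) / Real.logb b d * n)) = (b : ℝ) ^ (-((1 + t) * n)) := by
    have hexp : -((1 + t) * (n : ℝ)) =
        Real.logb b d * -((1 + t) / Real.logb b d * n) := by field_simp
    rw [hexp, Real.rpow_mul hb0.le, Real.rpow_logb hb0 hb1.ne' hd0]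
  rw [e] at hk
  have main : ∀ c c' : ℕ, c = d * c' → c ≤ b →
      distNearestInt ((c : ℝ) ^ n * x) ≤ (b : ℝ) ^ (-(t * n)) := by
    intro c c' hc hcb
    have hc0 : (0 : ℝ) ≤ (c : ℝ) ^ n := by positivity
    have hcr : (c : ℝ) ^ n = (d : ℝ) ^ n * (c' : ℝ) ^ n := by
      rw [← mul_pow]; exact_mod_cast congrArg (fun t : ℕ => (t : ℝ) ^ n) hc
    have h1 := round_le ((c : ℝ) ^ n * x) ((k * c' ^ n : ℕ) : ℤ)
    have h2 : (c : ℝ) ^ n * x - (((k * c' ^ n : ℕ) : ℤ) : ℝ) =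
        (c : ℝ) ^ n * (x - k / (d : ℝ) ^ n) := by
      rw [hcr]; push_cast; field_simp
    rw [h2, abs_mul, abs_of_nonneg hc0] at h1
    refine h1.trans ?_
    calc (c : ℝ) ^ n * |x - k / (d : ℝ) ^ n|
        ≤ (b : ℝ) ^ n * (b : ℝ) ^ (-((1 + t) * n)) := by gcongr
      _ = (b : ℝ) ^ (-(t * n)) := by
          rw [← Real.rpow_natCast, ← Real.rpow_add hb0]
          congr 1; ring
  exact max_lt ((main a a' ha' hab.le).trans_lt hn) ((main b b' hb' le_rfl).trans_lt hn)

/-! ### From the exponents t to the lower order τ -/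

theorem lt_logb_inv_div_iff {b y t : ℝ} {n : ℕ} (hb : 1 < b) (hy : 0 < y) (hn : 0 < n) :
    t < Real.logb b y⁻¹ / n ↔ y < b ^ (-(t * n)) := by
  rw [lt_div_iff₀ (by exact_mod_cast hn), Real.logb_inv, lt_neg, Real.logb_lt_iff_lt_rpow hb hy]

theorem logb_inv_div_lt_iff {b y t : ℝ} {n : ℕ} (hb : 1 < b) (hy : 0 < y) (hn : 0 < n) :
    Real.logb b y⁻¹ / n < t ↔ b ^ (-(t * n)) < y := by
  rw [div_lt_iff₀ (by exact_mod_cast hn), Real.logb_inv, neg_lt, Real.lt_logb_iff_rpow_lt hb hy]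

theorem theorem3 (a b : ℕ) (ha : 2 ≤ a) (hab : a < b) (ψ : ℕ → ℝ)
    (hψ : ∀ n : ℕ, 1 ≤ n → ψ n ∈ Set.Ioo (0 : ℝ) 1) (hτ : 1 < lowerOrder b ψ) :
    ((dimH (simulSet a b ψ) : ENNReal) : EReal) =
      ((Real.logb (b : ℝ) (Nat.gcd a b : ℝ) : ℝ) : EReal) / (1 + lowerOrder b ψ) := by
  have hb1 : (1 : ℝ) < b := by exact_mod_cast (by omega : 1 < b)
  have hd1 : (1 : ℝ) ≤ Nat.gcd a b := by
    exact_mod_cast Nat.gcd_pos_of_pos_left b (by omega : 0 < a)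
  have hlog : 0 ≤ Real.logb b (Nat.gcd a b) := Real.logb_nonneg hb1 hd1
  have hupper : ∀ t : ℝ, 1 < t → (t : EReal) < lowerOrder b ψ →
      dimH (simulSet a b ψ) ≤ ENNReal.ofReal (Real.logb b (Nat.gcd a b) / (1 + t)) := by
    intro t ht htτ
    refine simulSet_dimH_le ha hab ht ?_
    filter_upwards [eventually_lt_of_lt_liminf htτ, eventually_ge_atTop 1] with n hn hn1
    exact ((lt_logb_inv_div_iff hb1 (hψ n hn1).1 hn1).1 (EReal.coe_lt_coe_iff.1 hn)).le
  have hlower : ∀ t : ℝ, 0 ≤ t → lowerOrder b ψ < t →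
      ENNReal.ofReal (Real.logb b (Nat.gcd a b) / (1 + t)) ≤ dimH (simulSet a b ψ) := by
    intro t ht htτ
    refine le_simulSet_dimH ha hab ht ?_
    have hfreq := frequently_lt_of_liminf_lt (h := htτ)
    refine (hfreq.and_eventually (eventually_ge_atTop 1)).mono ?_
    rintro n ⟨hn, hn1⟩
    exact (logb_inv_div_lt_iff hb1 (hψ n hn1).1 hn1).1 (EReal.coe_lt_coe_iff.1 hn)
  have htend : ∀ τ : ℝ, 1 < τ → Tendsto
      (fun t : ℝ => ENNReal.ofReal (Real.logb b (Nat.gcd a b) / (1 + t))) (nhds τ)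
      (nhds (ENNReal.ofReal (Real.logb b (Nat.gcd a b) / (1 + τ)))) := fun τ hτ =>
    ENNReal.tendsto_ofReal ((tendsto_const_nhds).div (tendsto_const_nhds.add tendsto_id)
      (show (0 : ℝ) < 1 + τ by linarith).ne')
  induction hcase : lowerOrder b ψ with
  | bot => simp [hcase] at hτ
  | top =>
    have hlim : Tendsto (fun t : ℝ => ENNReal.ofReal (Real.logb b (Nat.gcd a b) / (1 + t))) atTop
        (nhds 0) := by
      rw [← ENNReal.ofReal_zero]
      exact ENNReal.tendsto_ofReal
        (tendsto_const_nhds.div_atTop (tendsto_atTop_add_const_left _ _ tendsto_id))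
    have h0 : dimH (simulSet a b ψ) ≤ 0 := ge_of_tendsto hlim (by
      filter_upwards [eventually_gt_atTop 1] with t ht
      exact hupper t ht (hcase ▸ EReal.coe_lt_top t))
    rw [nonpos_iff_eq_zero.1 h0, EReal.add_top_of_ne_bot (by decide), EReal.div_top]
    rfl
  | coe τ =>
    rw [hcase] at hτ hupper hlower
    have hτ1 : 1 < τ := by exact_mod_cast hτ
    -- The bounds hold for t on either side of τ; continuity at τ closes the gap.
    have h : dimH (simulSet a b ψ) = ENNReal.ofReal (Real.logb b (Nat.gcd a b) / (1 + τ)) := by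
      apply le_antisymm
      · refine ge_of_tendsto ((htend τ hτ1).mono_left (nhdsWithin_le_nhds (s := Set.Iio τ))) ?_
        filter_upwards [Ioo_mem_nhdsLT hτ1] with t ht
        exact hupper t ht.1 (by exact_mod_cast ht.2)
      · refine le_of_tendsto ((htend τ hτ1).mono_left (nhdsWithin_le_nhds (s := Set.Ioi τ))) ?_
        filter_upwards [self_mem_nhdsWithin] with t ht
        have ht : τ < t := ht
        exact hlower t (by linarith) (by exact_mod_cast ht)
    rw [h, EReal.coe_ennreal_ofReal, max_eq_left (by positivity), EReal.coe_div]
    rfl
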